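/- Let $0<\alpha<2$. Let $A\sim S_{\alpha/2}\big((\cos\frac{\pi\alpha}{4})^{2/\alpha},1,0\big)$ be an $\alpha/2$-stable random variable totally skewed to the right, that is, with $\sigma=(\cos\frac{\pi\alpha}{4})^{2/\alpha}$, $$\mathrm{E}\,e^{i\theta A}=\exp\Big\{-\sigma^{\alpha/2}|\theta|^{\alpha/2}\Big(1-i\,\mathrm{sign}(\theta)\tan\frac{\pi\alpha}{4}\Big)\Big\},\qquad \theta\in\mathbb{R},$$ and let $G=(G_1,G_2)$ be a zero-mean Gaussian vector in $\mathbb{R}^2$ independent of $A$. Put $R_{11}=\mathrm{E}G_1^2$, $R_{12}=\mathrm{E}(G_1G_2)$, $R_{22}=\mathrm{E}G_2^2$, and $$q(x,y)=\left|x^2R_{11}+2xyR_{12}+y^2R_{22}\right|^{\alpha/2}.$$ Let $\{\mathbf{Z}(t)\}_{t\in\mathbb{Z}}$ be a sub-Gaussian white noise: independent random vectors in $\mathbb{R}^2$, each distributed as $(A^{1/2}G_1,A^{1/2}G_2)$. Let $\Theta$ be a real $2\times2$ matrix, write $$\Theta^j=\begin{pmatrix}a_1^{(j)}&a_2^{(j)}\\a_3^{(j)}&a_4^{(j)}\end{pmatrix},\qquad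 j\ge 0,$$ and assume $\sum_{j\ge0}(|a_1^{(j)}|+|a_2^{(j)}|)<\infty$ and $\sum_{j\ge0}(|a_3^{(j)}|+|a_4^{(j)}|)<\infty$. Let $\{\mathbf{X}(t)\}_{t\in\mathbb{Z}}=\{(X_1(t),X_2(t))\}$ be a VAR(1) model with noise $\{\mathbf{Z}(t)\}$, that is, a strictly stationary process such that $\mathbf{X}(t)-\Theta\,\mathbf{X}(t-1)=\mathbf{Z}(t)$ almost surely for every $t\in\mathbb{Z}$. For real random variables $X,Y$ let $$\mathrm{CD}(X,Y)=\log \mathrm{E}\,e^{i(X-Y)}-\log \mathrm{E}\,e^{iX}-\log \mathrm{E}\,e^{-iY},$$ where $\log$ is the principal branch. Then for all $t\in\mathbb{Z}$ and all integers $h\ge0$ the expectations in the logarithms below are non-zero, the series below converge, and a) $$\mathrm{CD}(X_1(t),X_2(t+h))=\Big(\tfrac12\Big)^{\alpha/2}\sum_{j=0}^\infty q\big(a_1^{(j)},a_2^{(j)}\big)+\Big(\tfrac12\Big)^{\alpha/2}\sum_{j=0}^\infty q\big(a_3^{(j+h)},a_4^{(j+h)}\big)-\Big(\tfrac12\Big)^{\alpha/2}\sum_{j=0}^\infty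 q\big(a_1^{(j)}-a_3^{(j+h)},\,a_2^{(j)}-a_4^{(j+h)}\big),$$ b) $$\mathrm{CD}(X_1(t),X_2(t-h))=\Big(\tfrac12\Big)^{\alpha/2}\sum_{j=0}^\infty q\big(a_1^{(j+h)},a_2^{(j+h)}\big)+\Big(\tfrac12\Big)^{\alpha/2}\sum_{j=0}^\infty q\big(a_3^{(j)},a_4^{(j)}\big)-\Big(\tfrac12\Big)^{\alpha/2}\sum_{j=0}^\infty q\big(a_1^{(j+h)}-a_3^{(j)},\,a_2^{(j+h)}-a_4^{(j)}\big).$$ -/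

import Mathlib

open MeasureTheory ProbabilityTheory

noncomputable section

/-- The characteristic function at `θ` of the stable law `S_α(σ, β, μ)` with stability index `α`,
scale `σ`, skewness `β` and shift `μ`. -/
def stableCharFun (α σ β μ θ : ℝ) : ℂ :=
  if α = 1 then
    Complex.exp (-((σ * |θ| : ℝ) : ℂ) *
        (1 + Complex.I * ((β * Real.sign θ * (2 / Real.pi) * Real.log |θ| : ℝ) : ℂ))
      + Complex.I * ((μ * θ : ℝ) : ℂ))
  else
    Complex.exp (-((σ ^ α * |θ| ^ α : ℝ) : ℂ) *
        (1 - Complex.I * ((β * Real.sign θ * Real.tan (Real.pi * α / 2) : ℝ) : ℂ))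
      + Complex.I * ((μ * θ : ℝ) : ℂ))

/-- The real random variable `A` has the stable law `S_α(σ, β, μ)`. -/
structure IsStable {Ω : Type*} [MeasurableSpace Ω] (A : Ω → ℝ) (α σ β μ : ℝ)
    (P : Measure Ω) : Prop where
  aemeasurable : AEMeasurable A P
  index_pos : 0 < α
  index_le : α ≤ 2
  scale_pos : 0 < σ
  skew_mem : β ∈ Set.Icc (-1 : ℝ) 1
  charFun_eq : ∀ θ : ℝ, charFun (P.map A) θ = stableCharFun α σ β μ θ

/-- The ingredients of a sub-Gaussian vector in the plane: an `α/2`-stable variable `A`, totally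
skewed to the right, with scale `cos (π α / 4) ^ (2 / α)` and shift `0`, and an independent
centred Gaussian vector `G = (G₁, G₂)` (with index set `{0, 1}`). -/
structure IsSubGaussianPair {Ω : Type*} [MeasurableSpace Ω] (α : ℝ) (A : Ω → ℝ)
    (G : Ω → Fin 2 → ℝ) (P : Measure Ω) : Prop where
  stable : IsStable A (α / 2) (Real.cos (Real.pi * α / 4) ^ (2 / α)) 1 0 P
  gaussian : HasGaussianLaw G P
  mean_zero : ∀ i, ∫ ω, G ω i ∂P = 0
  indep : IndepFun A G P

/-- The matrix `R` with entries `R i j = E (G i * G j)`. -/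
def secondMoments {Ω : Type*} [MeasurableSpace Ω] (G : Ω → Fin 2 → ℝ) (P : Measure Ω) :
    Matrix (Fin 2) (Fin 2) ℝ :=
  fun i j => ∫ ω, G ω i * G ω j ∂P

/-- `Z` is the sub-Gaussian white noise generated by `(A, G)`: the vectors `Z t`, `t ∈ ℤ`, are
independent, and each of them has the law of `A ^ (1/2) * (G₁, G₂)`. (A totally skewed stable
variable with index less than one and shift `0` is almost surely nonnegative, so that the values
of `Real.sqrt` at negative numbers play no role.) -/
structure IsSubGaussianNoise {Ω Ω' : Type*} [MeasurableSpace Ω] [MeasurableSpace Ω']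
    (Z : ℤ → Ω → Fin 2 → ℝ) (P : Measure Ω) (A : Ω' → ℝ) (G : Ω' → Fin 2 → ℝ)
    (P' : Measure Ω') : Prop where
  indep : iIndepFun Z P
  law : ∀ t, IdentDistrib (Z t) (fun ω i => Real.sqrt (A ω) * G ω i) P P'

/-- Strict stationarity of a process indexed by `ℤ`: the finite-dimensional distributions are
invariant under time shifts. -/
def IsStrictlyStationary {Ω : Type*} [MeasurableSpace Ω] (X : ℤ → Ω → Fin 2 → ℝ)
    (P : Measure Ω) : Prop :=
  ∀ (n : ℕ) (τ : Fin n → ℤ) (s : ℤ),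
    IdentDistrib (fun ω k => X (τ k) ω) (fun ω k => X (τ k + s) ω) P P

/-- `X` is a bidimensional VAR(1) model with coefficient matrix `Θ` and noise `Z`: a stationary
solution of `X t - Θ X (t - 1) = Z t`. -/
structure IsVAR1 {Ω : Type*} [MeasurableSpace Ω] (Θ : Matrix (Fin 2) (Fin 2) ℝ)
    (X Z : ℤ → Ω → Fin 2 → ℝ) (P : Measure Ω) : Prop where
  stationary : IsStrictlyStationary X P
  recursion : ∀ t, ∀ᵐ ω ∂P, X t ω - Θ.mulVec (X (t - 1) ω) = Z t ω

/-- `E exp (i U)`. -/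
def expI {Ω : Type*} [MeasurableSpace Ω] (U : Ω → ℝ) (P : Measure Ω) : ℂ :=
  ∫ ω, Complex.exp (Complex.I * (U ω : ℂ)) ∂P

/-- The codifference
`CD(X, Y) = log E exp (i (X - Y)) - log E exp (i X) - log E exp (- i Y)`. -/
def codifference {Ω : Type*} [MeasurableSpace Ω] (X Y : Ω → ℝ) (P : Measure Ω) : ℂ :=
  Complex.log (expI (fun ω => X ω - Y ω) P) - Complex.log (expI X P)
    - Complex.log (expI (fun ω => -Y ω) P)

/-- The three expectations inside the logarithms of the codifference do not vanish. -/
def CodifferenceDefined {Ω : Type*} [MeasurableSpace Ω] (X Y : Ω → ℝ) (P : Measure Ω) : Prop :=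
  expI (fun ω => X ω - Y ω) P ≠ 0 ∧ expI X P ≠ 0 ∧ expI (fun ω => -Y ω) P ≠ 0

/-- The term `|x² R₁₁ + 2 x y R₁₂ + y² R₂₂| ^ (α / 2)`. -/
def qterm (α : ℝ) (R : Matrix (Fin 2) (Fin 2) ℝ) (x y : ℝ) : ℝ :=
  |x ^ 2 * R 0 0 + 2 * x * y * R 0 1 + y ^ 2 * R 1 1| ^ (α / 2)

end

/-! The characteristic function of `A` is `exp (-(-iθ) ^ (α / 2))`. A Liouville argument
(`laplace_of_charFun_eq`) deduces from this formula alone that `A ≥ 0` almost surely and that `E exp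
(-s A) = exp (-s ^ (α / 2))`. Conditioning on `A` then gives `E exp (i v·Z) = exp (-ψ v)`, where `ψ`
is `(1/2) ^ (α / 2)` times `qterm`.

Iterating the recursion writes a linear combination of `X t` and `X (t - h)` as a finite sum of
independent noise terms plus a remainder `w n · X (τ n)` with `w n → 0`. By stationarity the
remainder vanishes in law, so the characteristic function is `exp (-∑ ψ (v k))`
(`summable_and_expI_eq_exp_neg_tsum`). All three exponents in the codifference are real, so the
principal logarithm returns them. -/

open Filter Topology

/-! ### Positivity and Laplace transform of the totally skewed stable law. -/

/-- A continuous function which is holomorphic off the imaginary axis is entire. -/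
theorem Complex.differentiable_of_differentiableAt_off_imaginary_axis {f : ℂ → ℂ}
    (hc : Continuous f) (hd : ∀ z : ℂ, z.re ≠ 0 → DifferentiableAt ℂ f z) :
    Differentiable ℂ f := by
  rw [← differentiableOn_univ,
    ← Complex.isConservativeOn_and_continuousOn_iff_isDifferentiableOn isOpen_univ]
  refine ⟨fun z w _ => ?_, hc.continuousOn⟩
  rw [← add_eq_zero_iff_eq_neg, Complex.wedgeIntegral_add_wedgeIntegral_eq]
  -- Morera: the rectangle is split by the imaginary axis. Each piece needs holomorphy only in its
  -- interior, which misses the axis, and the two integrals along the axis cancel.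
  have h1 := Complex.integral_boundary_rect_eq_zero_of_continuousOn_of_differentiableOn f z
    ⟨0, w.im⟩ hc.continuousOn fun x hx => (hd x (by
      have := hx.1
      simp only [Set.mem_preimage, Set.mem_Ioo, min_lt_iff, lt_max_iff] at this
      grind)).differentiableWithinAt
  have h2 := Complex.integral_boundary_rect_eq_zero_of_continuousOn_of_differentiableOn f
    ⟨0, z.im⟩ w hc.continuousOn fun x hx => (hd x (by
      have := hx.1
      simp only [Set.mem_preimage, Set.mem_Ioo, min_lt_iff, lt_max_iff] at this
      grind)).differentiableWithinAt
  have hi : ∀ y a b : ℝ, IntervalIntegrable (fun x : ℝ => f (x + y * Complex.I)) volume a b :=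
    fun y a b => (hc.comp (by fun_prop)).intervalIntegrable _ _
  rw [← intervalIntegral.integral_add_adjacent_intervals (hi z.im z.re 0) (hi z.im 0 w.re),
    ← intervalIntegral.integral_add_adjacent_intervals (hi w.im z.re 0) (hi w.im 0 w.re)]
  linear_combination h1 + h2

section Laplace

variable {ν : Measure ℝ}

/-- The sign condition gives `|exp (z x)| ≤ 1`, so constants dominate. It holds for mass on `[0, ∞)`
with `Re z ≤ 0`, and for mass on `(-∞, 0)` with `Re z ≥ 0`. -/
theorem continuousOn_complexMGF_of_ae_mul_nonpos [IsFiniteMeasure ν] {S : Set ℂ}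
    (hS : ∀ z ∈ S, ∀ᵐ x ∂ν, z.re * x ≤ 0) : ContinuousOn (complexMGF id ν) S := by
  unfold complexMGF
  refine continuousOn_of_dominated (bound := fun _ => (1 : ℝ)) (fun z _ => ?_) (fun z hz => ?_)
    (integrable_const _) (ae_of_all _ fun x => ?_)
  · exact (by fun_prop : Continuous fun x : ℝ => Complex.exp (z * (id x : ℝ))).aestronglyMeasurable
  · filter_upwards [hS z hz] with x hx
    rw [Complex.norm_exp]
    simpa using hx
  · exact (by fun_prop : Continuous fun z : ℂ => Complex.exp (z * (id x : ℝ))).continuousOn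

theorem norm_complexMGF_le_of_ae_mul_nonpos [IsFiniteMeasure ν] {z : ℂ}
    (h : ∀ᵐ x ∂ν, z.re * x ≤ 0) : ‖complexMGF id ν z‖ ≤ ν.real Set.univ := by
  have := norm_integral_le_of_norm_le_const (μ := ν) (C := 1)
    (f := fun x : ℝ => Complex.exp (z * (id x : ℝ))) (by
      filter_upwards [h] with x hx
      rw [Complex.norm_exp]
      simpa using hx)
  simpa [complexMGF] using this

theorem differentiableAt_complexMGF_of_ae_mul_nonpos [IsFiniteMeasure ν] {U : Set ℝ}
    (hU : IsOpen U) (h : ∀ t ∈ U, ∀ᵐ x ∂ν, t * x ≤ 0) {z : ℂ} (hz : z.re ∈ U) :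
    DifferentiableAt ℂ (complexMGF id ν) z := by
  refine (analyticAt_complexMGF ?_).differentiableAt
  refine mem_interior.2 ⟨U, fun t ht => ?_, hU, hz⟩
  refine Integrable.of_bound (C := 1) ?_ ?_
  · exact (by fun_prop : Continuous fun x : ℝ => Real.exp (t * id x)).aestronglyMeasurable
  · filter_upwards [h t ht] with x hx
    simpa using hx

/-- `w ↦ w ^ a` has nonnegative real part on the right half-plane, for `0 < a ≤ 1`. -/
theorem Complex.cpow_ofReal_re_nonneg {a : ℝ} (ha0 : 0 < a) (ha1 : a ≤ 1) {w : ℂ}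
    (hw : 0 ≤ w.re) : 0 ≤ (w ^ (a : ℂ)).re := by
  rw [Complex.cpow_ofReal_re]
  refine mul_nonneg (by positivity) (Real.cos_nonneg_of_mem_Icc ?_)
  have h := Complex.abs_arg_le_pi_div_two_iff.2 hw
  rw [Set.mem_Icc, ← abs_le, abs_mul, abs_of_pos ha0]
  nlinarith [abs_nonneg w.arg]

/-- The branch cut meets the closed right half-plane only at `0`, where `a > 0` gives continuity. -/
theorem Complex.continuousOn_cpow_ofReal_re_nonneg {a : ℝ} (ha0 : 0 < a) :
    ContinuousOn (fun w : ℂ => w ^ (a : ℂ)) {w | 0 ≤ w.re} := by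
  intro w hw
  refine ContinuousAt.continuousWithinAt ?_
  by_cases h0 : w = 0
  · subst h0
    have := Complex.continuousAt_cpow_zero_of_re_pos (z := (a : ℂ)) (by simpa using ha0)
    exact ContinuousAt.comp (g := fun p : ℂ × ℂ => p.1 ^ p.2) (f := fun x : ℂ => (x, (a : ℂ)))
      this (by fun_prop)
  · by_cases him : w.im = 0
    · refine continuousAt_cpow_const (Or.inl (lt_of_le_of_ne hw fun h => h0 ?_))
      exact Complex.ext h.symm him
    · exact continuousAt_cpow_const (Or.inr him)

/-- A probability measure on the line whose characteristic function is
`θ ↦ exp (-(-iθ) ^ a)` with `0 < a ≤ 1` lives on `[0, ∞)` and has Laplace transform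
`s ↦ exp (-s ^ a)`. -/
theorem laplace_of_charFun_eq [IsProbabilityMeasure ν] {a : ℝ} (ha0 : 0 < a) (ha1 : a ≤ 1)
    (h : ∀ θ : ℝ, charFun ν θ = Complex.exp (-(-(Complex.I * θ)) ^ (a : ℂ))) :
    (∀ᵐ x ∂ν, 0 ≤ x) ∧
      ∀ s : ℝ, 0 ≤ s → ∫ x, Real.exp (-(s * x)) ∂ν = Real.exp (-s ^ a) := by
  set νp := ν.restrict (Set.Ici 0)
  set νn := ν.restrict (Set.Iio 0)
  have hp : ∀ t : ℝ, t ≤ 0 → ∀ᵐ x ∂νp, t * x ≤ 0 := fun t ht => by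
    filter_upwards [ae_restrict_mem measurableSet_Ici] with x hx
    exact mul_nonpos_of_nonpos_of_nonneg ht hx
  have hn : ∀ t : ℝ, 0 ≤ t → ∀ᵐ x ∂νn, t * x ≤ 0 := fun t ht => by
    filter_upwards [ae_restrict_mem measurableSet_Iio] with x hx
    exact mul_nonpos_of_nonneg_of_nonpos ht (le_of_lt hx)
  -- The two branches of `f` are the only candidates for the transform of the negative part `νn`.
  -- The hypothesis on `charFun` says that they agree on the imaginary axis, so `f` is entire and
  -- bounded, hence constant.
  set F : ℂ → ℂ := fun z => Complex.exp (-(-z) ^ (a : ℂ)) - complexMGF id νp z with hF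
  set f : ℂ → ℂ := fun z => if z.re ≤ 0 then F z else complexMGF id νn z with hf
  have hbd : ∀ z : ℂ, z.re = 0 → F z = complexMGF id νn z := by
    intro z hz
    have hzI : z = Complex.I * z.im := by
      apply Complex.ext <;> simp [hz]
    have h1 := h z.im
    rw [← hzI, charFun_apply_real] at h1
    have hint : Integrable (fun x : ℝ => Complex.exp (z.im * x * Complex.I)) ν := by
      refine Integrable.of_bound (C := 1) (by fun_prop) (ae_of_all _ fun x => ?_)
      rw [Complex.norm_exp]
      simp
    have e : ∀ x : ℝ, Complex.exp (z.im * x * Complex.I) = Complex.exp (z * (id x : ℝ)) :=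
      fun x => by
        conv_rhs => rw [hzI]
        congr 1
        simp only [id]
        ring
    simp only [e] at h1 hint
    simp only [hF]
    rw [sub_eq_iff_eq_add, ← h1, complexMGF, complexMGF, add_comm]
    have := integral_add_compl (μ := ν) (measurableSet_Ici (a := (0 : ℝ))) hint
    rw [Set.compl_Ici] at this
    exact this.symm
  have hFc : ContinuousOn F {z | z.re ≤ 0} := by
    refine ContinuousOn.sub ?_ (continuousOn_complexMGF_of_ae_mul_nonpos fun z hz => hp _ hz)
    refine Complex.continuous_exp.comp_continuousOn (ContinuousOn.neg ?_)
    exact (Complex.continuousOn_cpow_ofReal_re_nonneg ha0).comp (by fun_prop) fun z hz => by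
      simpa using hz
  have hc : Continuous f := by
    refine continuous_if_le (Complex.continuous_re) continuous_const hFc
      (continuousOn_complexMGF_of_ae_mul_nonpos fun z hz => hn _ hz) hbd
  have hd : Differentiable ℂ f := by
    refine Complex.differentiable_of_differentiableAt_off_imaginary_axis hc fun z hz => ?_
    rcases lt_or_gt_of_ne hz with hz | hz
    · have : f =ᶠ[𝓝 z] F := by
        filter_upwards [(isOpen_lt Complex.continuous_re continuous_const).mem_nhds hz] with w hw
        exact if_pos (le_of_lt hw)
      refine DifferentiableAt.congr_of_eventuallyEq ?_ this
      refine DifferentiableAt.sub ?_ (differentiableAt_complexMGF_of_ae_mul_nonpos isOpen_Iio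
        (fun t ht => hp t (le_of_lt ht)) hz)
      refine DifferentiableAt.cexp (DifferentiableAt.neg ?_)
      exact DifferentiableAt.cpow_const (by fun_prop) (Or.inl (by simpa using hz))
    · have : f =ᶠ[𝓝 z] complexMGF id νn := by
        filter_upwards [(isOpen_lt continuous_const Complex.continuous_re).mem_nhds hz] with w hw
        exact if_neg (not_le.2 hw)
      exact (differentiableAt_complexMGF_of_ae_mul_nonpos isOpen_Ioi
        (fun t ht => hn t (le_of_lt ht)) hz).congr_of_eventuallyEq this
  have hb : Bornology.IsBounded (Set.range f) := by
    refine (isBounded_iff_forall_norm_le.2 ⟨1 + νp.real Set.univ + νn.real Set.univ, ?_⟩)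
    rintro _ ⟨z, rfl⟩
    have e1 : 0 ≤ νp.real Set.univ := measureReal_nonneg
    have e2 : 0 ≤ νn.real Set.univ := measureReal_nonneg
    by_cases hz : z.re ≤ 0
    · have h1 : ‖Complex.exp (-(-z) ^ (a : ℂ))‖ ≤ 1 := by
        rw [Complex.norm_exp]
        simpa using Complex.cpow_ofReal_re_nonneg ha0 ha1 (w := -z) (by simpa using hz)
      have h2 := norm_complexMGF_le_of_ae_mul_nonpos (hp _ hz)
      simp only [hf, if_pos hz, hF]
      refine (norm_sub_le _ _).trans ?_
      linarith
    · have h2 := norm_complexMGF_le_of_ae_mul_nonpos (hn _ (le_of_lt (not_le.1 hz)))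
      simp only [hf, if_neg hz]
      linarith
  have hconst := fun z w => hd.apply_eq_apply_of_bounded hb z w
  -- The constant is found at `+∞`, where `exp (z x) → 0` for `x < 0`. The shift by `1` keeps every
  -- point strictly in the right half-plane.
  have hlim : Tendsto (fun n : ℕ => complexMGF id νn ((n : ℂ) + 1)) atTop (𝓝 (∫ x, (0 : ℂ) ∂νn)) := by
    refine tendsto_integral_of_dominated_convergence (fun _ => (1 : ℝ)) (fun n => ?_)
      (integrable_const _) (fun n => ?_) ?_
    · exact (by fun_prop :
        Continuous fun x : ℝ => Complex.exp (((n : ℂ) + 1) * (id x : ℝ))).aestronglyMeasurable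
    · filter_upwards [hn (n + 1) (by positivity)] with x hx
      rw [Complex.norm_exp]
      simpa using hx
    · filter_upwards [ae_restrict_mem measurableSet_Iio] with x hx
      rw [tendsto_zero_iff_norm_tendsto_zero]
      simp only [Complex.norm_exp]
      refine Real.tendsto_exp_atBot.comp ?_
      have : Tendsto (fun n : ℕ => ((n : ℝ) + 1) * x) atTop atBot :=
        (tendsto_atTop_add_const_right _ 1 tendsto_natCast_atTop_atTop).atTop_mul_const_of_neg hx
      simpa using this
  have hval : ∀ z, f z = 0 := by
    intro z
    have h1 : ∀ n : ℕ, complexMGF id νn ((n : ℂ) + 1) = f z := fun n => by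
      rw [hconst z ((n : ℂ) + 1), hf]
      refine (if_neg ?_).symm
      simp
      positivity
    simp only [h1, integral_zero] at hlim
    exact tendsto_nhds_unique tendsto_const_nhds hlim
  -- At `0` the vanishing function equals the total mass of `νn`.
  have hnull : νn = 0 := by
    have h0 := hval 0
    simp only [hf, Complex.zero_re, le_refl, if_true, hbd 0 rfl] at h0
    simp [complexMGF] at h0
    rw [measureReal_eq_zero_iff] at h0
    simpa [νn] using h0
  have hae : ∀ᵐ x ∂ν, 0 ≤ x := by
    have := Measure.restrict_eq_zero.1 hnull
    rw [ae_iff]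
    convert this using 2
    ext x
    simp
  refine ⟨hae, fun s hs => ?_⟩
  have h1 := hval (-(s : ℂ))
  have hνp : νp = ν := Measure.restrict_eq_self_of_ae_mem hae
  simp only [hf, hF, hνp, Complex.neg_re, Complex.ofReal_re, Left.neg_nonpos_iff, hs, if_true,
    neg_neg, complexMGF, id, sub_eq_zero] at h1
  apply Complex.ofReal_injective
  rw [← integral_complex_ofReal]
  push_cast
  rw [Complex.ofReal_cpow hs, h1]
  simp [neg_mul]

end Laplace

/-- For `θ ≠ 0` the principal argument of `-iθ` is `-sign θ · π / 2`. -/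
theorem Complex.neg_I_mul_cpow {a : ℝ} (ha : a ≠ 0) (θ : ℝ) :
    (-(Complex.I * θ)) ^ (a : ℂ) =
      ((|θ| ^ a : ℝ) : ℂ) * (Real.cos (Real.pi / 2 * a) -
        Complex.I * (Real.sign θ * Real.sin (Real.pi / 2 * a) : ℝ)) := by
  rcases lt_trichotomy θ 0 with h | h | h
  · have e : -(Complex.I * θ) = ((-θ : ℝ) : ℂ) * Complex.I := by push_cast; ring
    have h' : 0 < -θ := by linarith
    rw [Real.sign_of_neg h, abs_of_neg h, e]
    apply Complex.ext
    · rw [Complex.cpow_ofReal_re, Complex.norm_mul, Complex.norm_I, Complex.norm_real,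
        Complex.arg_real_mul _ h', Complex.arg_I, Real.norm_of_nonneg h'.le]
      simp [-Complex.ofReal_cos, -Complex.ofReal_sin]
    · rw [Complex.cpow_ofReal_im, Complex.norm_mul, Complex.norm_I, Complex.norm_real,
        Complex.arg_real_mul _ h', Complex.arg_I, Real.norm_of_nonneg h'.le]
      simp [-Complex.ofReal_cos, -Complex.ofReal_sin]
  · subst h
    simp [Real.zero_rpow ha, ha]
  · have e : -(Complex.I * θ) = (θ : ℂ) * -Complex.I := by ring
    rw [Real.sign_of_pos h, abs_of_pos h, e]
    apply Complex.ext
    · rw [Complex.cpow_ofReal_re, Complex.norm_mul, norm_neg, Complex.norm_I, Complex.norm_real,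
        Complex.arg_real_mul _ h, Complex.arg_neg_I, Real.norm_of_nonneg h.le]
      simp [-Complex.ofReal_cos, -Complex.ofReal_sin]
    · rw [Complex.cpow_ofReal_im, Complex.norm_mul, norm_neg, Complex.norm_I, Complex.norm_real,
        Complex.arg_real_mul _ h, Complex.arg_neg_I, Real.norm_of_nonneg h.le]
      simp [-Complex.ofReal_cos, -Complex.ofReal_sin]

/-- The scale is normalised so that its power `α / 2` is `cos (π α / 4)`; this factor turns `1 - i
sign θ tan` into `cos - i sign θ sin`. -/
theorem stableCharFun_totally_skewed {α : ℝ} (hα0 : 0 < α) (hα2 : α < 2) (θ : ℝ) :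
    stableCharFun (α / 2) (Real.cos (Real.pi * α / 4) ^ (2 / α)) 1 0 θ =
      Complex.exp (-(-(Complex.I * θ)) ^ ((α / 2 : ℝ) : ℂ)) := by
  have hcos : 0 < Real.cos (Real.pi * α / 4) := by
    apply Real.cos_pos_of_mem_Ioo
    constructor <;> nlinarith [Real.pi_pos]
  have hσ : (Real.cos (Real.pi * α / 4) ^ (2 / α)) ^ (α / 2) = Real.cos (Real.pi * α / 4) := by
    rw [← Real.rpow_mul hcos.le, show 2 / α * (α / 2) = 1 by field_simp, Real.rpow_one]
  have ht : Real.pi * (α / 2) / 2 = Real.pi * α / 4 := by ring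
  have ht' : Real.pi / 2 * (α / 2) = Real.pi * α / 4 := by ring
  have hs : Real.sin (Real.pi * α / 4) =
      Real.cos (Real.pi * α / 4) * Real.tan (Real.pi * α / 4) := by
    rw [Real.tan_eq_sin_div_cos]; field_simp
  rw [stableCharFun, if_neg (by linarith), Complex.neg_I_mul_cpow (by positivity), hσ, ht, ht', hs]
  congr 1
  push_cast
  ring

/-! ### Characteristic function of the sub-Gaussian noise. -/

section Noise

variable {Ω : Type*} [MeasurableSpace Ω] {P : Measure Ω}

/-- The quadratic form `E (x G₁ + y G₂)²`. -/
theorem integral_linear_comb_sq {G : Ω → Fin 2 → ℝ} (hG : HasGaussianLaw G P) (x y : ℝ) :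
    ∫ ω, (x * G ω 0 + y * G ω 1) ^ 2 ∂P =
      x ^ 2 * secondMoments G P 0 0 + 2 * x * y * secondMoments G P 0 1 +
        y ^ 2 * secondMoments G P 1 1 := by
  have hi : ∀ i, MemLp (fun ω => G ω i) 2 P := fun i => (hG.eval i).memLp_two
  have hij : ∀ i j, Integrable (fun ω => G ω i * G ω j) P := fun i j => (hi i).integrable_mul (hi j)
  have e : ∀ ω, (x * G ω 0 + y * G ω 1) ^ 2 = x ^ 2 * (G ω 0 * G ω 0) +
    2 * x * y * (G ω 0 * G ω 1) + y ^ 2 * (G ω 1 * G ω 1) := fun ω => by ring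
  simp only [e, secondMoments]
  have h01 : Integrable (fun ω => x ^ 2 * (G ω 0 * G ω 0) + 2 * x * y * (G ω 0 * G ω 1)) P :=
    ((hij 0 0).const_mul _).add ((hij 0 1).const_mul _)
  rw [integral_add h01 ((hij 1 1).const_mul _),
    integral_add ((hij 0 0).const_mul _) ((hij 0 1).const_mul _)]
  simp only [integral_const_mul]

theorem integral_cexp_gaussian {U : Ω → ℝ} (hU : HasGaussianLaw U P) (h0 : ∫ ω, U ω ∂P = 0)
    (s : ℝ) :
    ∫ u, Complex.exp (Complex.I * (s * u : ℝ)) ∂(P.map U) =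
      Complex.exp (-((s ^ 2 * ((∫ ω, U ω ^ 2 ∂P) / 2) : ℝ) : ℂ)) := by
  have h := charFun_gaussianReal (μ := ∫ ω, U ω ∂P) (v := Var[U; P].toNNReal) s
  rw [← hU.map_eq_gaussianReal, charFun_apply_real, h0,
    Real.coe_toNNReal _ (variance_nonneg _ _), variance_of_integral_eq_zero hU.aemeasurable h0] at h
  convert h using 1
  · congr 1 with u
    congr 1
    push_cast
    ring
  · congr 1
    push_cast
    ring

/-- Given `A = a ≥ 0`, the variable is centred Gaussian with variance `a Q`, where `Q = E U²`.
Integrating `exp (-a Q / 2)` over `a` gives the Laplace transform of `A` at `Q / 2`, the source of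
the factor `(1/2) ^ (α / 2)`. -/
theorem IsSubGaussianPair.expI_eq [IsProbabilityMeasure P] {α : ℝ} (hα0 : 0 < α) (hα2 : α < 2)
    {A : Ω → ℝ} {G : Ω → Fin 2 → ℝ} (hAG : IsSubGaussianPair α A G P) (x y : ℝ) :
    expI (fun ω => x * (Real.sqrt (A ω) * G ω 0) + y * (Real.sqrt (A ω) * G ω 1)) P =
      Complex.exp (-(((1 / 2 : ℝ) ^ (α / 2) * qterm α (secondMoments G P) x y : ℝ) : ℂ)) := by
  set U : Ω → ℝ := fun ω => x * G ω 0 + y * G ω 1 with hU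
  have hA := hAG.stable.aemeasurable
  have hUg : HasGaussianLaw U P := by
    have := hAG.gaussian.map_fun
      (x • ContinuousLinearMap.proj (R := ℝ) (φ := fun _ : Fin 2 => ℝ) 0 +
        y • ContinuousLinearMap.proj (R := ℝ) (φ := fun _ : Fin 2 => ℝ) 1)
    simpa [hU] using this
  have hU0 : ∫ ω, U ω ∂P = 0 := by
    rw [integral_add ((hAG.gaussian.eval 0).integrable.const_mul _)
      ((hAG.gaussian.eval 1).integrable.const_mul _)]
    simp [integral_const_mul, hAG.mean_zero]
  have hind : IndepFun A U P :=
    hAG.indep.comp (φ := id) (ψ := fun v : Fin 2 → ℝ => x * v 0 + y * v 1) measurable_id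
      (by fun_prop)
  have : IsProbabilityMeasure (P.map A) := Measure.isProbabilityMeasure_map hA
  have : IsProbabilityMeasure (P.map U) := Measure.isProbabilityMeasure_map hUg.aemeasurable
  obtain ⟨hpos, hlap⟩ := laplace_of_charFun_eq (ν := P.map A) (a := α / 2) (by linarith)
    (by linarith) fun θ => by rw [hAG.stable.charFun_eq, stableCharFun_totally_skewed hα0 hα2]
  set Q : ℝ := ∫ ω, U ω ^ 2 ∂P with hQ
  have hQ0 : 0 ≤ Q := integral_nonneg fun ω => sq_nonneg _
  have hmeas : Measurable fun p : ℝ × ℝ =>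
      Complex.exp (Complex.I * (Real.sqrt p.1 * p.2 : ℝ)) := by fun_prop
  calc expI (fun ω => x * (Real.sqrt (A ω) * G ω 0) + y * (Real.sqrt (A ω) * G ω 1)) P
      = ∫ ω, Complex.exp (Complex.I * (Real.sqrt (A ω) * U ω : ℝ)) ∂P := by
        unfold expI
        congr 1 with ω
        congr 3
        simp only [hU]
        ring
    _ = ∫ p, Complex.exp (Complex.I * (Real.sqrt p.1 * p.2 : ℝ)) ∂((P.map A).prod (P.map U)) := by
        rw [← (indepFun_iff_map_prod_eq_prod_map_map hA hUg.aemeasurable).1 hind,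
          integral_map (hA.prodMk hUg.aemeasurable) hmeas.aestronglyMeasurable]
    _ = ∫ a, ∫ u, Complex.exp (Complex.I * (Real.sqrt a * u : ℝ)) ∂(P.map U) ∂(P.map A) := by
        refine integral_prod _ (Integrable.of_bound (C := 1) hmeas.aestronglyMeasurable
          (ae_of_all _ fun p => ?_))
        rw [Complex.norm_exp]
        simp
    _ = ∫ a, ((Real.exp (-(Q / 2 * a)) : ℝ) : ℂ) ∂(P.map A) := by
        refine integral_congr_ae ?_
        filter_upwards [hpos] with a ha
        rw [integral_cexp_gaussian hUg hU0, Real.sq_sqrt ha]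
        push_cast
        congr 1
        ring
    _ = _ := by
        rw [integral_complex_ofReal, hlap _ (by positivity), Complex.ofReal_exp]
        congr 1
        rw [← Complex.ofReal_neg, qterm, ← integral_linear_comb_sq hAG.gaussian,
          ← Real.mul_rpow (by norm_num) (abs_nonneg _)]
        -- The absolute value in `qterm` is harmless, since the form is a second moment.
        rw [abs_of_nonneg hQ0, hQ]
        congr 3
        ring

end Noise

/-! ### Infinite moving averages with a vanishing remainder. -/

section MovingAverage

variable {Ω : Type*} [MeasurableSpace Ω] {P : Measure Ω}

theorem norm_cexp_I_mul_ofReal (u : ℝ) : ‖Complex.exp (Complex.I * u)‖ = 1 := by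
  rw [Complex.norm_exp]
  simp

theorem aestronglyMeasurable_cexp_I_mul {U : Ω → ℝ} (hU : AEMeasurable U P) :
    AEStronglyMeasurable (fun ω => Complex.exp (Complex.I * (U ω : ℂ))) P :=
  (by fun_prop : Continuous fun u : ℝ =>
    Complex.exp (Complex.I * (u : ℂ))).comp_aestronglyMeasurable hU.aestronglyMeasurable

theorem integrable_cexp_I_mul [IsFiniteMeasure P] {U : Ω → ℝ} (hU : AEMeasurable U P) :
    Integrable (fun ω => Complex.exp (Complex.I * (U ω : ℂ))) P :=
  Integrable.of_bound (C := 1) (aestronglyMeasurable_cexp_I_mul hU)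
    (ae_of_all _ fun _ => (norm_cexp_I_mul_ofReal _).le)

/-- No independence of `S` and `E` is needed, and the bound depends only on the law of `E`. -/
theorem norm_expI_add_sub_expI_le [IsFiniteMeasure P] {S E : Ω → ℝ} (hS : AEMeasurable S P)
    (hE : AEMeasurable E P) :
    ‖expI (fun ω => S ω + E ω) P - expI S P‖ ≤
      ∫ ω, ‖Complex.exp (Complex.I * (E ω : ℂ)) - 1‖ ∂P := by
  have hSE : AEMeasurable (fun ω => S ω + E ω) P := hS.add hE
  unfold expI
  rw [← integral_sub (integrable_cexp_I_mul hSE) (integrable_cexp_I_mul hS)]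
  refine (norm_integral_le_integral_norm _).trans (le_of_eq ?_)
  congr 1 with ω
  have : Complex.exp (Complex.I * ((S ω + E ω : ℝ) : ℂ)) - Complex.exp (Complex.I * (S ω : ℂ)) =
      Complex.exp (Complex.I * (S ω : ℂ)) * (Complex.exp (Complex.I * (E ω : ℂ)) - 1) := by
    push_cast
    rw [mul_add, Complex.exp_add]
    ring
  rw [this, norm_mul, norm_cexp_I_mul_ofReal, one_mul]

theorem tendsto_integral_norm_cexp_sub_one [IsFiniteMeasure P] {V : Ω → Fin 2 → ℝ}
    (hV : AEMeasurable V P) {w : ℕ → Fin 2 → ℝ} (hw : Tendsto w atTop (𝓝 0)) :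
    Tendsto (fun n => ∫ ω, ‖Complex.exp (Complex.I * ((w n ⬝ᵥ V ω : ℝ) : ℂ)) - 1‖ ∂P) atTop
      (𝓝 0) := by
  have h := tendsto_integral_of_dominated_convergence (μ := P) (f := fun _ => (0 : ℝ))
    (F := fun n ω => ‖Complex.exp (Complex.I * ((w n ⬝ᵥ V ω : ℝ) : ℂ)) - 1‖) (fun _ => (2 : ℝ))
    (fun n => ?_) (integrable_const _) (fun n => ae_of_all _ fun ω => ?_)
    (ae_of_all _ fun ω => ?_)
  · simpa using h
  · exact ((aestronglyMeasurable_cexp_I_mul (by fun_prop)).sub aestronglyMeasurable_const).norm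
  · rw [norm_norm]
    refine (norm_sub_le _ _).trans ?_
    rw [norm_cexp_I_mul_ofReal, norm_one]
    norm_num
  · have hc : Continuous fun u : Fin 2 → ℝ =>
        ‖Complex.exp (Complex.I * ((u ⬝ᵥ V ω : ℝ) : ℂ)) - 1‖ := by
      unfold dotProduct
      fun_prop
    simpa [Function.comp_def] using (hc.tendsto 0).comp hw

theorem expI_sum_eq_exp [IsProbabilityMeasure P] {Z : ℤ → Ω → Fin 2 → ℝ} (hZi : iIndepFun Z P)
    (hZm : ∀ t, AEMeasurable (Z t) P) {ψ : (Fin 2 → ℝ) → ℝ}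
    (hZ : ∀ t v, expI (fun ω => v ⬝ᵥ Z t ω) P = Complex.exp (-(ψ v : ℂ)))
    {s : ℕ → ℤ} (hs : Function.Injective s) (v : ℕ → Fin 2 → ℝ) (n : ℕ) :
    expI (fun ω => ∑ k ∈ Finset.range n, v k ⬝ᵥ Z (s k) ω) P =
      Complex.exp (-((∑ k ∈ Finset.range n, ψ (v k) : ℝ) : ℂ)) := by
  have hi : iIndepFun (fun k : Fin n => Z (s k)) P :=
    hZi.precomp (g := fun k : Fin n => s k) fun i j hij => Fin.ext (hs hij)
  have h := hi.integral_fun_prod_comp (𝕜 := ℂ)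
    (f := fun (k : Fin n) u => Complex.exp (Complex.I * ((v k ⬝ᵥ u : ℝ) : ℂ))) (fun k => hZm _)
    fun k => by
      refine Continuous.aestronglyMeasurable ?_
      unfold dotProduct
      fun_prop
  calc expI (fun ω => ∑ k ∈ Finset.range n, v k ⬝ᵥ Z (s k) ω) P
      = ∫ ω, ∏ k : Fin n, Complex.exp (Complex.I * ((v k ⬝ᵥ Z (s k) ω : ℝ) : ℂ)) ∂P := by
        unfold expI
        congr 1 with ω
        simp only [← Complex.exp_sum, Finset.sum_range, Complex.ofReal_sum, Finset.mul_sum]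
    _ = ∏ k : Fin n, Complex.exp (-(ψ (v k) : ℂ)) := by
        rw [h]
        exact Finset.prod_congr rfl fun k _ => hZ _ _
    _ = _ := by
        rw [← Complex.exp_sum, Finset.sum_range, Complex.ofReal_sum, Finset.sum_neg_distrib]

theorem IsStrictlyStationary.identDistrib {X : ℤ → Ω → Fin 2 → ℝ} (hX : IsStrictlyStationary X P)
    (t t' : ℤ) : IdentDistrib (X t) (X t') P P := by
  have h := (hX 1 (fun _ => t) (t' - t)).comp
    (u := fun f : Fin 1 → Fin 2 → ℝ => f 0) (by fun_prop)
  simpa [Function.comp_def] using h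

/-- By stationarity the error bound for `w n ⬝ᵥ X (τ n)` can be computed with the fixed vector `X
0`, and dominated convergence applies as `w n → 0`. -/
theorem tendsto_exp_neg_sum_expI [IsProbabilityMeasure P] {Z X : ℤ → Ω → Fin 2 → ℝ}
    (hZi : iIndepFun Z P) (hZm : ∀ t, AEMeasurable (Z t) P) {ψ : (Fin 2 → ℝ) → ℝ}
    (hZ : ∀ t v, expI (fun ω => v ⬝ᵥ Z t ω) P = Complex.exp (-(ψ v : ℂ)))
    (hX : IsStrictlyStationary X P) {s τ : ℕ → ℤ} (hs : Function.Injective s)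
    {v w : ℕ → Fin 2 → ℝ} (hw : Tendsto w atTop (𝓝 0)) {U : Ω → ℝ}
    (hU : ∀ᶠ n in atTop, ∀ᵐ ω ∂P,
      U ω = ∑ k ∈ Finset.range n, v k ⬝ᵥ Z (s k) ω + w n ⬝ᵥ X (τ n) ω) :
    Tendsto (fun n => Complex.exp (-((∑ k ∈ Finset.range n, ψ (v k) : ℝ) : ℂ))) atTop
      (𝓝 (expI U P)) := by
  have hXm : ∀ t, AEMeasurable (X t) P := fun t => (hX.identDistrib t t).aemeasurable_fst
  rw [← tendsto_sub_nhds_zero_iff]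
  refine squeeze_zero_norm' ?_ (tendsto_integral_norm_cexp_sub_one (hXm 0) hw)
  filter_upwards [hU] with n hn
  have hS : AEMeasurable (fun ω => ∑ k ∈ Finset.range n, v k ⬝ᵥ Z (s k) ω) P :=
    Finset.aemeasurable_fun_sum _ fun k _ => by have := hZm (s k); fun_prop
  have hE : AEMeasurable (fun ω => w n ⬝ᵥ X (τ n) ω) P := by have := hXm (τ n); fun_prop
  have e : expI U P =
      expI (fun ω => ∑ k ∈ Finset.range n, v k ⬝ᵥ Z (s k) ω + w n ⬝ᵥ X (τ n) ω) P := by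
    refine integral_congr_ae ?_
    filter_upwards [hn] with ω hω
    rw [hω]
  rw [norm_sub_rev, ← expI_sum_eq_exp hZi hZm hZ hs, e]
  refine (norm_expI_add_sub_expI_le hS hE).trans (le_of_eq ?_)
  refine ((hX.identDistrib (τ n) 0).comp
    (u := fun x => ‖Complex.exp (Complex.I * ((w n ⬝ᵥ x : ℝ) : ℂ)) - 1‖) ?_).integral_eq
  fun_prop

/-- The characteristic function of a real random variable does not vanish near the origin. -/
theorem exists_ne_zero_expI_const_mul_ne_zero [IsProbabilityMeasure P] {U : Ω → ℝ}
    (hU : AEMeasurable U P) : ∃ u : ℝ, u ≠ 0 ∧ expI (fun ω => u * U ω) P ≠ 0 := by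
  have h : Tendsto (fun n : ℕ => expI (fun ω => (1 / ((n : ℝ) + 1)) * U ω) P) atTop
      (𝓝 (∫ _, (1 : ℂ) ∂P)) := by
    refine tendsto_integral_of_dominated_convergence (fun _ => (1 : ℝ)) (fun n => ?_)
      (integrable_const _) (fun n => ae_of_all _ fun ω => (norm_cexp_I_mul_ofReal _).le)
      (ae_of_all _ fun ω => ?_)
    · exact aestronglyMeasurable_cexp_I_mul (by fun_prop)
    · have hc : Continuous fun u : ℝ => Complex.exp (Complex.I * ((u * U ω : ℝ) : ℂ)) := by
        fun_prop
      simpa [Function.comp_def] using (hc.tendsto 0).comp tendsto_one_div_add_atTop_nhds_zero_nat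
  obtain ⟨n, hn⟩ := (h.eventually_ne (b₂ := 0) (by simp)).exists
  exact ⟨_, by positivity, hn⟩

/-- The characteristic function of an infinite moving average of independent vectors whose
characteristic functions are `exp (-ψ)`, `ψ` nonnegative and homogeneous. -/
theorem summable_and_expI_eq_exp_neg_tsum [IsProbabilityMeasure P] {Z X : ℤ → Ω → Fin 2 → ℝ}
    (hZi : iIndepFun Z P) (hZm : ∀ t, AEMeasurable (Z t) P) {ψ : (Fin 2 → ℝ) → ℝ} {α : ℝ}
    (hψ0 : ∀ v, 0 ≤ ψ v) (hψ : ∀ (u : ℝ) v, ψ (u • v) = |u| ^ α * ψ v)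
    (hZ : ∀ t v, expI (fun ω => v ⬝ᵥ Z t ω) P = Complex.exp (-(ψ v : ℂ)))
    (hX : IsStrictlyStationary X P) {s τ : ℕ → ℤ} (hs : Function.Injective s)
    {v w : ℕ → Fin 2 → ℝ} (hw : Tendsto w atTop (𝓝 0)) {U : Ω → ℝ} (hUm : AEMeasurable U P)
    (hU : ∀ᶠ n in atTop, ∀ᵐ ω ∂P,
      U ω = ∑ k ∈ Finset.range n, v k ⬝ᵥ Z (s k) ω + w n ⬝ᵥ X (τ n) ω) :
    Summable (fun k => ψ (v k)) ∧ expI U P = Complex.exp (-((∑' k, ψ (v k) : ℝ) : ℂ)) := by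
  have hsum : Summable (fun k => ψ (v k)) := by
    obtain ⟨u, hu, hne⟩ := exists_ne_zero_expI_const_mul_ne_zero hUm
    have h := tendsto_exp_neg_sum_expI hZi hZm hZ hX hs (v := fun k => u • v k) (τ := τ)
      (w := fun k => u • w k) (U := fun ω => u * U ω) (by simpa using hw.const_smul u) (by
        filter_upwards [hU] with n hn
        filter_upwards [hn] with ω hω
        rw [hω]
        simp [mul_add, Finset.mul_sum])
    -- A divergent series would force the characteristic function of `U` to vanish at `u`, contrary
    -- to the choice of `u`. Homogeneity of `ψ` then removes the factor `u`.
    have hsu : Summable (fun k => ψ (u • v k)) := by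
      by_contra hns
      have ht := (not_summable_iff_tendsto_nat_atTop_of_nonneg fun k => hψ0 (u • v k)).1 hns
      refine hne (tendsto_nhds_unique h ?_)
      rw [tendsto_zero_iff_norm_tendsto_zero]
      simp only [Complex.norm_exp, Complex.neg_re, Complex.ofReal_re]
      exact Real.tendsto_exp_atBot.comp (tendsto_neg_atTop_atBot.comp ht)
    simp only [hψ] at hsu
    exact (summable_mul_left_iff (Real.rpow_pos_of_pos (abs_pos.2 hu) α).ne').1 hsu
  refine ⟨hsum, tendsto_nhds_unique (tendsto_exp_neg_sum_expI hZi hZm hZ hX hs hw hU) ?_⟩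
  have hc : Continuous fun r : ℝ => Complex.exp (-(r : ℂ)) := by fun_prop
  exact (hc.tendsto _).comp hsum.hasSum.tendsto_sum_nat

end MovingAverage

/-! ### The VAR(1) model and its codifference. -/

theorem qterm_nonneg (α : ℝ) (R : Matrix (Fin 2) (Fin 2) ℝ) (x y : ℝ) : 0 ≤ qterm α R x y :=
  Real.rpow_nonneg (abs_nonneg _) _

theorem qterm_neg (α : ℝ) (R : Matrix (Fin 2) (Fin 2) ℝ) (x y : ℝ) :
    qterm α R (-x) (-y) = qterm α R x y := by
  simp [qterm]

theorem qterm_mul (α : ℝ) (R : Matrix (Fin 2) (Fin 2) ℝ) (u x y : ℝ) :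
    qterm α R (u * x) (u * y) = |u| ^ α * qterm α R x y := by
  have e : (u * x) ^ 2 * R 0 0 + 2 * (u * x) * (u * y) * R 0 1 + (u * y) ^ 2 * R 1 1 =
      u ^ 2 * (x ^ 2 * R 0 0 + 2 * x * y * R 0 1 + y ^ 2 * R 1 1) := by ring
  have hu : |u| ^ α = (|u| ^ 2) ^ (α / 2) := by
    rw [← Real.rpow_natCast, ← Real.rpow_mul (abs_nonneg _)]
    congr 1
    push_cast
    ring
  rw [qterm, qterm, e, abs_mul, Real.mul_rpow (abs_nonneg _) (abs_nonneg _), abs_pow, hu]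

section VAR

variable {Ω Ω' : Type*} [MeasurableSpace Ω] [MeasurableSpace Ω'] {P : Measure Ω}
  {P' : Measure Ω'} {Θ : Matrix (Fin 2) (Fin 2) ℝ}

theorem expI_congr_identDistrib {U : Ω → ℝ} {V : Ω' → ℝ} (h : IdentDistrib U V P P') :
    expI U P = expI V P' :=
  (h.comp (u := fun x : ℝ => Complex.exp (Complex.I * (x : ℂ))) (by fun_prop)).integral_eq

theorem IsSubGaussianNoise.expI_eq [IsProbabilityMeasure P'] {α : ℝ} (hα0 : 0 < α) (hα2 : α < 2)
    {A : Ω' → ℝ} {G : Ω' → Fin 2 → ℝ} (hAG : IsSubGaussianPair α A G P')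
    {Z : ℤ → Ω → Fin 2 → ℝ} (hZ : IsSubGaussianNoise Z P A G P') (t : ℤ) (v : Fin 2 → ℝ) :
    expI (fun ω => v ⬝ᵥ Z t ω) P =
      Complex.exp (-(((1 / 2 : ℝ) ^ (α / 2) *
        qterm α (secondMoments G P') (v 0) (v 1) : ℝ) : ℂ)) := by
  rw [← hAG.expI_eq hα0 hα2]
  have h := expI_congr_identDistrib ((hZ.law t).comp (u := fun x => v ⬝ᵥ x) (by fun_prop))
  simpa only [Function.comp_def, dotProduct, Fin.sum_univ_two] using h

/-- Iterating the recursion expresses `X t` through the last `n` noise vectors and `X (t - n)`. -/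
theorem IsVAR1.ae_eq_sum {X Z : ℤ → Ω → Fin 2 → ℝ} (hX : IsVAR1 Θ X Z P) :
    ∀ᵐ ω ∂P, ∀ (p : Fin 2 → ℝ) (n : ℕ) (t : ℤ), p ⬝ᵥ X t ω =
      ∑ k ∈ Finset.range n, Matrix.vecMul p (Θ ^ k) ⬝ᵥ Z (t - k) ω +
        Matrix.vecMul p (Θ ^ n) ⬝ᵥ X (t - n) ω := by
  filter_upwards [ae_all_iff.2 hX.recursion] with ω hω p n t
  induction n with
  | zero => simp
  | succ n ih =>
    have e : X (t - n) ω = Z (t - n) ω + Θ.mulVec (X (t - (n + 1 : ℕ)) ω) := by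
      have := hω (t - n)
      rw [← this]
      push_cast
      rw [sub_sub, sub_add_cancel]
    rw [ih, e, Finset.sum_range_succ, dotProduct_add, Matrix.dotProduct_mulVec,
      Matrix.vecMul_vecMul, ← pow_succ, add_assoc]

theorem expI_linear_comb_var [IsProbabilityMeasure P] {X Z : ℤ → Ω → Fin 2 → ℝ}
    (hX : IsVAR1 Θ X Z P) (hZi : iIndepFun Z P) (hZm : ∀ t, AEMeasurable (Z t) P)
    {ψ : (Fin 2 → ℝ) → ℝ} {α : ℝ}
    (hψ0 : ∀ v, 0 ≤ ψ v) (hψ : ∀ (u : ℝ) v, ψ (u • v) = |u| ^ α * ψ v)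
    (hZ : ∀ t v, expI (fun ω => v ⬝ᵥ Z t ω) P = Complex.exp (-(ψ v : ℂ)))
    (hΘ : Tendsto (fun n => Θ ^ n) atTop (𝓝 0)) (p r : Fin 2 → ℝ) (t : ℤ) (h : ℕ) :
    Summable (fun k : ℕ => ψ (Matrix.vecMul p (Θ ^ (k + h)) + Matrix.vecMul r (Θ ^ k))) ∧
      expI (fun ω => p ⬝ᵥ X t ω + r ⬝ᵥ X (t - h) ω) P =
        Complex.exp (-((∑ k ∈ Finset.range h, ψ (Matrix.vecMul p (Θ ^ k)) +
          ∑' k : ℕ, ψ (Matrix.vecMul p (Θ ^ (k + h)) + Matrix.vecMul r (Θ ^ k)) : ℝ) : ℂ)) := by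
  -- `v k` is the coefficient of `Z (t - k)`; `X (t - h)` contributes only from `k = h` on.
  set v : ℕ → Fin 2 → ℝ := fun k =>
    Matrix.vecMul p (Θ ^ k) + if h ≤ k then Matrix.vecMul r (Θ ^ (k - h)) else 0 with hv
  have hXm : ∀ t, AEMeasurable (X t) P := fun t =>
    (hX.stationary.identDistrib t t).aemeasurable_fst
  have htend : ∀ q : Fin 2 → ℝ, Tendsto (fun n => Matrix.vecMul q (Θ ^ n)) atTop (𝓝 0) :=
    fun q => by
      have hc : Continuous fun M : Matrix (Fin 2) (Fin 2) ℝ => Matrix.vecMul q M := by fun_prop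
      simpa [Function.comp_def] using (hc.tendsto 0).comp hΘ
  have hlow : ∀ k, k < h → v k = Matrix.vecMul p (Θ ^ k) := fun k hk => by
    simp [hv, not_le.2 hk]
  have hhigh : ∀ k, v (k + h) = Matrix.vecMul p (Θ ^ (k + h)) + Matrix.vecMul r (Θ ^ k) :=
    fun k => by simp [hv]
  obtain ⟨hsum, hexp⟩ := summable_and_expI_eq_exp_neg_tsum hZi hZm hψ0 hψ hZ hX.stationary
    (s := fun k : ℕ => t - k) (τ := fun k : ℕ => t - k)
    (fun i j hij => by simpa using hij) (v := v)
    -- The truncated `n - h` does no harm, because the expansion is required only for large `n`.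
    (w := fun n => Matrix.vecMul p (Θ ^ n) + Matrix.vecMul r (Θ ^ (n - h)))
    (by simpa using (htend p).add ((htend r).comp (tendsto_sub_atTop_nat h)))
    (U := fun ω => p ⬝ᵥ X t ω + r ⬝ᵥ X (t - h) ω)
    (by have h1 := hXm t; have h2 := hXm (t - h); fun_prop) (by
      filter_upwards [eventually_ge_atTop h] with n hn
      obtain ⟨m, rfl⟩ := Nat.exists_eq_add_of_le hn
      filter_upwards [hX.ae_eq_sum] with ω hω
      have e : ∀ k : ℕ, t - h - k = t - ((h + k : ℕ) : ℤ) := fun k => by push_cast; ring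
      rw [hω p (h + m) t, hω r m (t - h)]
      simp only [hv, add_dotProduct, Finset.sum_add_distrib, Nat.add_sub_cancel_left, e]
      rw [Finset.sum_range_add (fun k => (if h ≤ k then Matrix.vecMul r (Θ ^ (k - h)) else 0) ⬝ᵥ
        Z (t - k) ω), Finset.sum_eq_zero (s := Finset.range h) fun k hk => by
          simp [not_le.2 (Finset.mem_range.1 hk)]]
      simp
      ring)
  refine ⟨by simpa only [hhigh] using (summable_nat_add_iff h).2 hsum, ?_⟩
  rw [hexp, ← hsum.sum_add_tsum_nat_add h]
  simp only [hhigh]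
  rw [Finset.sum_congr rfl fun k hk => by rw [hlow k (Finset.mem_range.1 hk)]]

theorem codifference_eq_of_expI_eq {X Y : Ω → ℝ} {a b c : ℝ}
    (ha : expI (fun ω => X ω - Y ω) P = Complex.exp (-(a : ℂ)))
    (hb : expI X P = Complex.exp (-(b : ℂ)))
    (hc : expI (fun ω => -Y ω) P = Complex.exp (-(c : ℂ))) :
    CodifferenceDefined X Y P ∧ codifference X Y P = ((b + c - a : ℝ) : ℂ) := by
  have hlog : ∀ x : ℝ, Complex.log (Complex.exp (-(x : ℂ))) = -(x : ℂ) := fun x => by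
    rw [← Complex.ofReal_neg, ← Complex.ofReal_exp, ← Complex.ofReal_log (Real.exp_pos _).le,
      Real.log_exp]
  rw [CodifferenceDefined, codifference, ha, hb, hc, hlog, hlog, hlog]
  refine ⟨⟨Complex.exp_ne_zero _, Complex.exp_ne_zero _, Complex.exp_ne_zero _⟩, ?_⟩
  push_cast
  ring

/-- Decay of the powers is all that is drawn from the summability hypotheses; the series of `qterm`
converge by the moving-average argument. -/
theorem Matrix.tendsto_pow_zero_of_summable_rows
    (hΘ1 : Summable fun j : ℕ => |(Θ ^ j) 0 0| + |(Θ ^ j) 0 1|)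
    (hΘ2 : Summable fun j : ℕ => |(Θ ^ j) 1 0| + |(Θ ^ j) 1 1|) :
    Tendsto (fun n => Θ ^ n) atTop (𝓝 0) := by
  have h1 := hΘ1.tendsto_atTop_zero
  have h2 := hΘ2.tendsto_atTop_zero
  refine tendsto_pi_nhds.2 fun i => tendsto_pi_nhds.2 fun j => ?_
  fin_cases i <;> fin_cases j
  · exact squeeze_zero_norm (fun n => le_add_of_nonneg_right (abs_nonneg _)) h1
  · exact squeeze_zero_norm (fun n => le_add_of_nonneg_left (abs_nonneg _)) h1
  · exact squeeze_zero_norm (fun n => le_add_of_nonneg_right (abs_nonneg _)) h2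
  · exact squeeze_zero_norm (fun n => le_add_of_nonneg_left (abs_nonneg _)) h2

end VAR

/-- With `Θ ^ j = !![a₁⁽ʲ⁾, a₂⁽ʲ⁾; a₃⁽ʲ⁾, a₄⁽ʲ⁾]`, so that `(Θ ^ j) 0 0 = a₁⁽ʲ⁾` and so on, and with
`X t ω 0`, `X t ω 1` the two components of the process. -/
theorem lemma4p1 {Ω Ω' : Type*} [MeasurableSpace Ω] [MeasurableSpace Ω']
    (P : Measure Ω) [IsProbabilityMeasure P] (P' : Measure Ω') [IsProbabilityMeasure P']
    (α : ℝ) (hα0 : 0 < α) (hα2 : α < 2)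
    (A : Ω' → ℝ) (G : Ω' → Fin 2 → ℝ) (hAG : IsSubGaussianPair α A G P')
    (R : Matrix (Fin 2) (Fin 2) ℝ) (hR : R = secondMoments G P')
    (Z : ℤ → Ω → Fin 2 → ℝ) (hZ : IsSubGaussianNoise Z P A G P')
    (Θ : Matrix (Fin 2) (Fin 2) ℝ)
    (hΘ1 : Summable fun j : ℕ => |(Θ ^ j) 0 0| + |(Θ ^ j) 0 1|)
    (hΘ2 : Summable fun j : ℕ => |(Θ ^ j) 1 0| + |(Θ ^ j) 1 1|)
    (X : ℤ → Ω → Fin 2 → ℝ) (hX : IsVAR1 Θ X Z P)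
    (t : ℤ) (h : ℕ) :
    (CodifferenceDefined (fun ω => X t ω 0) (fun ω => X (t + h) ω 1) P ∧
      (Summable fun j : ℕ => qterm α R ((Θ ^ j) 0 0) ((Θ ^ j) 0 1)) ∧
      (Summable fun j : ℕ => qterm α R ((Θ ^ (j + h)) 1 0) ((Θ ^ (j + h)) 1 1)) ∧
      (Summable fun j : ℕ => qterm α R ((Θ ^ j) 0 0 - (Θ ^ (j + h)) 1 0)
        ((Θ ^ j) 0 1 - (Θ ^ (j + h)) 1 1)) ∧
      codifference (fun ω => X t ω 0) (fun ω => X (t + h) ω 1) P =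
        (((1 / 2 : ℝ) ^ (α / 2) * ∑' j : ℕ, qterm α R ((Θ ^ j) 0 0) ((Θ ^ j) 0 1)
          + (1 / 2 : ℝ) ^ (α / 2) *
              ∑' j : ℕ, qterm α R ((Θ ^ (j + h)) 1 0) ((Θ ^ (j + h)) 1 1)
          - (1 / 2 : ℝ) ^ (α / 2) *
              ∑' j : ℕ, qterm α R ((Θ ^ j) 0 0 - (Θ ^ (j + h)) 1 0)
                ((Θ ^ j) 0 1 - (Θ ^ (j + h)) 1 1) : ℝ) : ℂ)) ∧
    (CodifferenceDefined (fun ω => X t ω 0) (fun ω => X (t - h) ω 1) P ∧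
      (Summable fun j : ℕ => qterm α R ((Θ ^ (j + h)) 0 0) ((Θ ^ (j + h)) 0 1)) ∧
      (Summable fun j : ℕ => qterm α R ((Θ ^ j) 1 0) ((Θ ^ j) 1 1)) ∧
      (Summable fun j : ℕ => qterm α R ((Θ ^ (j + h)) 0 0 - (Θ ^ j) 1 0)
        ((Θ ^ (j + h)) 0 1 - (Θ ^ j) 1 1)) ∧
      codifference (fun ω => X t ω 0) (fun ω => X (t - h) ω 1) P =
        (((1 / 2 : ℝ) ^ (α / 2) *
              ∑' j : ℕ, qterm α R ((Θ ^ (j + h)) 0 0) ((Θ ^ (j + h)) 0 1)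
          + (1 / 2 : ℝ) ^ (α / 2) * ∑' j : ℕ, qterm α R ((Θ ^ j) 1 0) ((Θ ^ j) 1 1)
          - (1 / 2 : ℝ) ^ (α / 2) *
              ∑' j : ℕ, qterm α R ((Θ ^ (j + h)) 0 0 - (Θ ^ j) 1 0)
                ((Θ ^ (j + h)) 0 1 - (Θ ^ j) 1 1) : ℝ) : ℂ)) := by
  subst hR
  set R := secondMoments G P' with hR
  set c : ℝ := (1 / 2 : ℝ) ^ (α / 2) with hc
  have hc0 : 0 < c := by positivity
  have hZm : ∀ t, AEMeasurable (Z t) P := fun t => (hZ.law t).aemeasurable_fst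
  have key := expI_linear_comb_var hX hZ.indep hZm
    (ψ := fun v => c * qterm α R (v 0) (v 1)) (α := α)
    (fun v => mul_nonneg hc0.le (qterm_nonneg _ _ _ _))
    (fun u v => by simp only [Pi.smul_apply, smul_eq_mul, qterm_mul]; ring)
    (fun t v => hZ.expI_eq hα0 hα2 hAG t v)
    (Matrix.tendsto_pow_zero_of_summable_rows hΘ1 hΘ2)
  clear_value c R
  -- The marginals are the case `r = 0`, `h = 0`. For the differences, the later of the two times
  -- must carry `p`: this is `-e₂` in a) and `e₁` in b).
  have k1 : ∀ s, _ := fun s => key (Pi.single 0 1) 0 s 0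
  have k2 : ∀ s, _ := fun s => key (-Pi.single 1 1) 0 s 0
  have ka := key (-Pi.single 1 1) (Pi.single 0 1) (t + h) h
  have kb := key (Pi.single 0 1) (-Pi.single 1 1) t h
  simp only [Matrix.neg_vecMul, Matrix.single_one_vecMul, Matrix.zero_vecMul, add_zero,
    zero_dotProduct, neg_dotProduct, single_one_dotProduct, Finset.range_zero, Finset.sum_empty,
    zero_add, mul_zero, Pi.zero_apply, Pi.neg_apply, Pi.add_apply, Matrix.row_apply, qterm_neg, tsum_mul_left,
    summable_mul_left_iff hc0.ne', add_sub_cancel_right, ← Finset.mul_sum, neg_add_eq_sub,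
    ← sub_eq_add_neg] at k1 k2 ka kb
  have s1 := (k1 t).1
  have s2 := (k2 t).1
  have ⟨a1, a2⟩ := codifference_eq_of_expI_eq ka.2 (k1 t).2 (k2 (t + h)).2
  have ⟨b1, b2⟩ := codifference_eq_of_expI_eq kb.2 (k1 t).2 (k2 (t - h)).2
  have s1' := (summable_nat_add_iff h).2 s1
  have s2' := (summable_nat_add_iff h).2 s2
  refine ⟨⟨a1, s1, s2', ka.1, ?_⟩,
    b1, s1', s2, kb.1, ?_⟩
  -- The `h` noise terms later than time `t` enter only `X₂(t + h)`. They cancel between the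
  -- marginal and the difference, leaving the series shifted by `h`; in b) the same happens with
  -- `X₁(t)`.
  · rw [a2, ← s2.sum_add_tsum_nat_add h]
    congr 1
    ring
  · rw [b2, ← s1.sum_add_tsum_nat_add h]
    congr 1
    ring
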